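/- For a polynomial $f(x)=\sum_i a_i x^i\in\mathbb{Z}[x]$ write $\|f\|=\sum_i |a_i|$; divisibility of polynomials is meant in $\mathbb{Z}[x]$, and $\log$ is the natural logarithm. **Theorem.** For every $\varepsilon>0$ there exists an integer $n_0$ with the following property. Let $q,f\in\mathbb{Z}[x]$ with $f(1)\neq 0$, let $m$ be a positive integer such that $q(x)$ divides $(x^m-1)f(x)$, and let $n$ be the degree of $(x^m-1)f(x)$. Assume that $n\ge n_0$ and that $\|f\|\le n^{c}$ for some real number $c<100\log 2-2$. If there exist a positive integer $k$ and a nonzero integer $l$ such that $q(x)$ divides $l(x^k-1)$, then the smallest positive integer $k$ for which such a nonzero integer $l$ exists satisfies $$\log k\le n^{\frac13+\varepsilon}.$$ -/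

import Mathlib

open Polynomial

/-- The norm `‖f‖ = ∑ |a_i|` of an integer polynomial `f = ∑ a_i x^i`. -/
noncomputable def coeffNorm (f : ℤ[X]) : ℝ := ∑ i ∈ f.support, |(f.coeff i : ℝ)|

/-- The set of positive integers `k` such that `q` divides `l (x^k - 1)` in `ℤ[x]`
for some nonzero integer `l`. -/
def cycloExponents (q : ℤ[X]) : Set ℕ :=
  {k : ℕ | 0 < k ∧ ∃ l : ℤ, l ≠ 0 ∧ q ∣ C l * (X ^ k - 1)}

/-! Since `x^k - 1` is a product of distinct cyclotomic polynomials, in `q ∣ l (x^k - 1)` only the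
`Φ_d ∣ q` matter, and each of these divides `x^m - 1` or `f`. Hence `m * L` is an admissible
exponent whenever `L` is a common multiple of all `d` with `Φ_d ∣ f` (`mul_mem_cycloExponents`). As
`φ(d) ≤ n`, prime powers dividing `d` are at most `2n`, so `L ≤ (2n)^c` with `c` the number of
primes dividing some such `d`. It remains to show `c ≤ n^(1/3 + o(1))`.

Put `N ≈ n^(1/3)` and write `d = e p^a` with `p ∤ e`. There are at most `N` primes `p ≤ N`. If `p`
and `e` both exceed `N`, then `d ≥ N^2`; the sum of all `φ(d)` is at most `n`, which leaves about `n
/ N^2` such `d`, each with few prime factors.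

For `e ≤ N`, let `M(d)` be the multiplicity of `Φ_d` in `f`. The Hasse derivative of `f` of order
`M(e)` at a primitive `e`-th root of unity is a nonzero algebraic integer, divisible by the product
of the `p^M(e p^a)`, with all conjugates at most `n^M(e) ‖f‖` (`prod_pow_cycloMult_le`). So few `p`
occur for a given `e` unless `M(e)` is large. The same inequality, iterated over the number of prime
factors of `e` from `M(1) = 0` (as `f(1) ≠ 0`), bounds the sum of `M(e)` over `e ≤ N` by `N n^o(1)`
(`cycloMultSum_le`, `eventually_choose_le_rpow`). -/

/-! ### Multiplicities of cyclotomic factors: the basic inequality -/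

/-- If `z` is a root of `g`, the `r`-th Hasse derivative of `g ^ r * h` at `z` is
`g'(z) ^ r * h(z)`. -/
lemma eval_hasseDeriv_pow_mul {R : Type*} [CommRing R] (g h : R[X]) (z : R) (r : ℕ)
    (hg : g.eval z = 0) :
    (hasseDeriv r (g ^ r * h)).eval z = (derivative g).eval z ^ r * h.eval z := by
  rw [← taylor_coeff]
  have h0 : (taylor z g).coeff 0 = 0 := by rw [taylor_coeff_zero, hg]
  obtain ⟨b, hb⟩ := X_dvd_iff.2 h0
  have hb0 : b.coeff 0 = (derivative g).eval z := by
    rw [← taylor_coeff_one, hb, mul_comm, coeff_mul_X]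
  have ht : taylor z (g ^ r * h) = X ^ r * (b ^ r * taylor z h) := by
    rw [taylor_mul, taylor_pow, hb]
    ring
  rw [ht, coeff_X_pow_mul', if_pos le_rfl, Nat.sub_self, mul_coeff_zero, taylor_coeff_zero,
    ← hb0]
  congr 1
  simp [coeff_zero_eq_eval_zero]

/-- `p` divides the value of `Φ_{e p^a}` at a root of `Φ_e`, if `p ∤ e`. -/
lemma prime_dvd_aeval_cyclotomic {R : Type*} [CommRing R] (z : R) {p e a : ℕ} (hp : p.Prime)
    (hpe : ¬ p ∣ e) (ha : 0 < a) (hz : aeval z (cyclotomic e ℤ) = 0) :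
    (p : R) ∣ aeval z (cyclotomic (e * p ^ a) ℤ) := by
  have : Fact p.Prime := ⟨hp⟩
  set k := p ^ a - p ^ (a - 1) with hk
  have hk0 : k ≠ 0 := by
    have : p ^ (a - 1) < p ^ a := Nat.pow_lt_pow_right hp.one_lt (by omega)
    omega
  -- Modulo `p`, `Φ_{e p^a}` is the power `Φ_e ^ φ(p^a)`, which vanishes at `z`.
  have h1 : map (Int.castRingHom (ZMod p)) (cyclotomic (e * p ^ a) ℤ - cyclotomic e ℤ ^ k) = 0 := by
    rw [Polynomial.map_sub, Polynomial.map_pow, map_cyclotomic, map_cyclotomic, mul_comm,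
      cyclotomic_mul_prime_pow_eq (ZMod p) hpe ha, sub_self]
  have h2 : C (p : ℤ) ∣ cyclotomic (e * p ^ a) ℤ - cyclotomic e ℤ ^ k := by
    rw [C_dvd_iff_dvd_coeff]
    intro i
    have := congrArg (fun q => coeff q i) h1
    simp only [coeff_map, coeff_zero] at this
    exact (ZMod.intCast_zmod_eq_zero_iff_dvd _ p).1 (by simpa using this)
  obtain ⟨u, hu⟩ := h2
  refine ⟨aeval z u, ?_⟩
  have := congrArg (aeval z) hu
  simp only [map_sub, map_pow, hz, map_mul, zero_pow hk0, sub_zero] at this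
  simpa using this

/-- The norm of `a` is a nonzero integer, so its conjugates cannot all lie in the open unit disc. -/
lemma exists_one_le_norm_embedding {K : Type*} [Field K] [NumberField K]
    {a : NumberField.RingOfIntegers K} (ha : a ≠ 0) : ∃ φ : K →+* ℂ, 1 ≤ ‖φ a‖ := by
  by_contra! h
  have h' : ∀ w : NumberField.InfinitePlace K, w (a : K) < 1 := fun w => by
    rw [← NumberField.InfinitePlace.norm_embedding_eq]; exact h _
  obtain ⟨w⟩ : Nonempty (NumberField.InfinitePlace K) := inferInstance
  exact absurd (NumberField.InfinitePlace.one_le_of_lt_one (w := w) ha fun z _ => h' z)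
    (not_le.2 (h' w))

lemma norm_aeval_hasseDeriv_le (f : ℤ[X]) (n r : ℕ) (hf : f.natDegree ≤ n) (z : ℂ)
    (hz : ‖z‖ = 1) : ‖aeval z (hasseDeriv r f)‖ ≤ (n : ℝ) ^ r * coeffNorm f := by
  rw [hasseDeriv_apply, Polynomial.sum, map_sum, coeffNorm, Finset.mul_sum]
  refine (norm_sum_le _ _).trans (Finset.sum_le_sum fun i hi => ?_)
  rw [aeval_monomial, norm_mul, norm_pow, hz, one_pow, mul_one]
  simp only [eq_intCast, Int.cast_mul, Int.cast_natCast, norm_mul, Complex.norm_natCast,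
    Complex.norm_intCast]
  gcongr
  have h1 : i ≤ n := (le_natDegree_of_mem_supp i hi).trans hf
  exact_mod_cast (Nat.choose_le_pow i r).trans (Nat.pow_le_pow_left h1 r)

lemma prime_cyclotomic {d : ℕ} (hd : 0 < d) : Prime (cyclotomic d ℤ) :=
  (cyclotomic.irreducible hd).prime

lemma isRelPrime_cyclotomic {d e : ℕ} (hd : 0 < d) (he : 0 < e) (hde : d ≠ e) :
    IsRelPrime (cyclotomic d ℤ) (cyclotomic e ℤ) := by
  rw [(cyclotomic.irreducible hd).isRelPrime_iff_not_dvd]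
  intro h
  refine hde (cyclotomic_injective (R := ℤ) ?_)
  exact eq_of_monic_of_associated (cyclotomic.monic d ℤ) (cyclotomic.monic e ℤ)
    ((cyclotomic.irreducible hd).associated_of_dvd (cyclotomic.irreducible he) h)

/-- The multiplicity of the `d`-th cyclotomic polynomial in `f`. -/
noncomputable def cycloMult (f : ℤ[X]) (d : ℕ) : ℕ := multiplicity (cyclotomic d ℤ) f

lemma cycloMult_pos_iff {f : ℤ[X]} {d : ℕ} :
    0 < cycloMult f d ↔ cyclotomic d ℤ ∣ f := by
  rw [cycloMult, Nat.pos_iff_ne_zero, ne_eq, multiplicity_eq_zero, not_not]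

lemma prod_cyclotomic_pow_cycloMult_dvd (f : ℤ[X]) (D : Finset ℕ) (hD : ∀ d ∈ D, 0 < d) :
    ∏ d ∈ D, cyclotomic d ℤ ^ cycloMult f d ∣ f := by
  refine Finset.prod_dvd_of_isRelPrime ?_ fun d _ => pow_multiplicity_dvd _ _
  intro d hd e he hde
  exact (isRelPrime_cyclotomic (hD d hd) (hD e he) hde).pow

/-- The product of the `p ^ M(e p^a)` over cyclotomic factors `Φ_{e p^a}` of `f` is bounded in
terms of the multiplicity of `Φ_e`. -/
lemma prod_pow_cycloMult_le {f : ℤ[X]} (hf : f ≠ 0) {n : ℕ} (hn : f.natDegree ≤ n) {e : ℕ}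
    (he : 0 < e) (D : Finset ℕ) (p : ℕ → ℕ)
    (hD : ∀ d ∈ D, (p d).Prime ∧ ¬ p d ∣ e ∧ ∃ a, 0 < a ∧ d = e * p d ^ a) :
    ((∏ d ∈ D, p d ^ cycloMult f d : ℕ) : ℝ) ≤ (n : ℝ) ^ cycloMult f e * coeffNorm f := by
  have : NeZero e := ⟨he.ne'⟩
  have heD : e ∉ D := by
    intro h
    obtain ⟨hp, -, a, ha, h⟩ := hD e h
    have h1 : 1 < p e ^ a := Nat.one_lt_pow ha.ne' hp.one_lt
    have : e * 1 < e * p e ^ a := Nat.mul_lt_mul_of_pos_left h1 he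
    omega
  have hpos : ∀ d ∈ insert e D, 0 < d := by
    intro d hd
    rcases Finset.mem_insert.1 hd with rfl | hd
    · exact he
    · obtain ⟨hp, -, a, -, h⟩ := hD d hd
      rw [h]
      exact Nat.mul_pos he (pow_pos hp.pos a)
  obtain ⟨w, hw⟩ := prod_cyclotomic_pow_cycloMult_dvd f (insert e D) hpos
  rw [Finset.prod_insert heD, mul_assoc] at hw
  set r := cycloMult f e with hr
  set A := ∏ d ∈ D, cyclotomic d ℤ ^ cycloMult f d with hA
  let K := CyclotomicField e ℚ
  have : IsCyclotomicExtension {e} ℚ K := CyclotomicField.isCyclotomicExtension e ℚ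
  let O := NumberField.RingOfIntegers K
  let ζ : K := IsCyclotomicExtension.zeta e ℚ K
  have hζ : IsPrimitiveRoot ζ e := IsCyclotomicExtension.zeta_spec e ℚ K
  let z : O := hζ.toInteger
  have hz : IsPrimitiveRoot z e := hζ.toInteger_isPrimitiveRoot
  have hev : ∀ g : ℤ[X], aeval z g = (g.map (algebraMap ℤ O)).eval z := fun g => by
    rw [eval_map_algebraMap]
  have hmin : cyclotomic e ℤ = minpoly ℤ z := by
    rw [cyclotomic_eq_minpoly hζ he]
    exact minpoly.algebraMap_eq (NumberField.RingOfIntegers.coe_injective) z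
  have hroot : aeval z (cyclotomic e ℤ) = 0 := by rw [hmin, minpoly.aeval]
  -- Otherwise `Φ_e ^ (r + 1)` would divide `f`, against the choice of `r` as the exact
  -- multiplicity.
  have hndvd : aeval z (A * w) ≠ 0 := by
    intro h
    have h1 : cyclotomic e ℤ ∣ A * w := by
      rw [hmin]
      exact minpoly.isIntegrallyClosed_dvd (NumberField.RingOfIntegers.isIntegral z) h
    have h2 : cyclotomic e ℤ ^ (r + 1) ∣ f := by
      rw [hw, pow_succ]
      exact mul_dvd_mul_left _ h1
    exact (FiniteMultiplicity.of_prime_left (prime_cyclotomic he) hf).not_pow_dvd_of_multiplicity_lt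
      (Nat.lt_succ_self _) h2
  have hder : aeval z (derivative (cyclotomic e ℤ)) ≠ 0 := by
    intro h
    have h1 : cyclotomic e ℤ ∣ derivative (cyclotomic e ℤ) := by
      conv_lhs => rw [hmin]
      exact minpoly.isIntegrallyClosed_dvd (NumberField.RingOfIntegers.isIntegral z) h
    have h2 : 0 < (cyclotomic e ℤ).natDegree := by
      rw [natDegree_cyclotomic]; exact Nat.totient_pos.2 he
    have h3 := natDegree_le_of_dvd h1 (by
      intro h0
      have := derivative_eq_zero.1 h0
      omega)
    have := natDegree_derivative_lt h2.ne'
    omega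
  have hH : aeval z (hasseDeriv r f) =
      aeval z (derivative (cyclotomic e ℤ)) ^ r * aeval z (A * w) := by
    have h1 : (hasseDeriv r f).map (algebraMap ℤ O) = hasseDeriv r (f.map (algebraMap ℤ O)) := by
      ext i
      simp [hasseDeriv_coeff]
    rw [hev, h1, hev, hev, ← derivative_map, ← eval_hasseDeriv_pow_mul _ _ _ _
      (by rw [← hev, hroot]), ← Polynomial.map_pow, ← Polynomial.map_mul, ← hw]
  have hne : aeval z (hasseDeriv r f) ≠ 0 := by
    rw [hH]
    exact mul_ne_zero (pow_ne_zero _ hder) hndvd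
  have hdvd : ((∏ d ∈ D, p d ^ cycloMult f d : ℕ) : O) ∣ aeval z (hasseDeriv r f) := by
    rw [hH, map_mul, ← mul_assoc, mul_comm (_ ^ r), mul_assoc]
    refine Dvd.dvd.mul_right ?_ _
    rw [hA, map_prod]
    rw [Nat.cast_prod]
    refine Finset.prod_dvd_prod_of_dvd _ _ fun d hd => ?_
    obtain ⟨hp, hpe, a, ha, h⟩ := hD d hd
    rw [map_pow, Nat.cast_pow]
    refine pow_dvd_pow_of_dvd ?_ _
    have := prime_dvd_aeval_cyclotomic z hp hpe ha hroot
    rwa [← h] at this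
  obtain ⟨v, hv⟩ := hdvd
  have hv0 : v ≠ 0 := by
    rintro rfl
    exact hne (by rw [hv, mul_zero])
  -- In this embedding the value of the Hasse derivative is at least as large as the integer
  -- dividing it.
  obtain ⟨φ, hφ⟩ := exists_one_le_norm_embedding hv0
  have hψ : φ ((aeval z (hasseDeriv r f) : O) : K) = aeval (φ ζ) (hasseDeriv r f) := by
    have h1 : ((aeval z (hasseDeriv r f) : O) : K) = aeval ζ (hasseDeriv r f) := by
      have := aeval_algebraMap_apply K z (hasseDeriv r f)
      exact this.symm
    rw [h1, aeval_def, hom_eval₂, aeval_def]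
    congr 1
    exact RingHom.ext_int _ _
  have hnorm : ‖φ ζ‖ = 1 :=
    (hζ.map_of_injective φ.injective).norm'_eq_one he.ne'
  refine le_trans ?_ (norm_aeval_hasseDeriv_le f n r hn (φ ζ) hnorm)
  rw [← hψ, hv]
  simp only [map_mul, map_natCast, norm_mul, Complex.norm_natCast]
  exact le_mul_of_one_le_right (Nat.cast_nonneg _) hφ

/-- The base-2 logarithm of `prod_pow_cycloMult_le`, using `p ≥ 2` and `n ≤ 2 ^ K`. -/
lemma sum_cycloMult_le {f : ℤ[X]} (hf : f ≠ 0) {n K A : ℕ} (hn : f.natDegree ≤ n)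
    (hA : coeffNorm f ≤ (n : ℝ) ^ A) (hK : n ≤ 2 ^ K) {e : ℕ} (he : 0 < e) (D : Finset ℕ)
    (hD : ∀ d ∈ D, ∃ p a, p.Prime ∧ ¬ p ∣ e ∧ 0 < a ∧ d = e * p ^ a) :
    ∑ d ∈ D, cycloMult f d ≤ K * (A + cycloMult f e) := by
  classical
  choose! p a hp hpe ha hda using hD
  have h1 := prod_pow_cycloMult_le hf hn he D p
    fun d hd => ⟨hp d hd, hpe d hd, a d, ha d hd, hda d hd⟩
  have h2 : ((∏ d ∈ D, p d ^ cycloMult f d : ℕ) : ℝ) ≤ ((n ^ (A + cycloMult f e) : ℕ) : ℝ) := by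
    refine h1.trans ?_
    push_cast
    rw [pow_add, mul_comm]
    gcongr
  have h3 : ∏ d ∈ D, p d ^ cycloMult f d ≤ n ^ (A + cycloMult f e) := by exact_mod_cast h2
  have h4 : 2 ^ ∑ d ∈ D, cycloMult f d ≤ 2 ^ (K * (A + cycloMult f e)) := by
    rw [pow_mul, ← Finset.prod_pow_eq_pow_sum]
    refine (Finset.prod_le_prod' fun d hd => ?_).trans (h3.trans (Nat.pow_le_pow_left hK _))
    exact Nat.pow_le_pow_left (hp d hd).two_le _
  exact (Nat.pow_le_pow_iff_right (by norm_num)).1 h4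

/-! ### Induction on the number of prime factors -/

/-- The sum of the multiplicities of `Φ_d` in `f` over `d ≤ N` with exactly `s` prime factors. -/
noncomputable def cycloMultSum (f : ℤ[X]) (N s : ℕ) : ℕ :=
  ∑ d ∈ (Finset.Icc 1 N).filter fun d => d.primeFactors.card = s, cycloMult f d

lemma primeFactors_ordCompl (d p : ℕ) : (ordCompl[p] d).primeFactors = d.primeFactors.erase p := by
  rw [← Nat.support_factorization, Nat.factorization_ordCompl, Finsupp.support_erase,
    Nat.support_factorization]

/-- Double counting of pairs `(e, d)` with `d = e p^a`: each `d` has `s + 1` such `e`, one per prime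
factor, and `sum_cycloMult_le` bounds the sum over `d` for fixed `e`. -/
lemma succ_mul_cycloMultSum_succ_le {f : ℤ[X]} (hf : f ≠ 0) {n K A : ℕ} (hn : f.natDegree ≤ n)
    (hA : coeffNorm f ≤ (n : ℝ) ^ A) (hK : n ≤ 2 ^ K) (N s : ℕ) :
    (s + 1) * cycloMultSum f N (s + 1) ≤ K * (A * N + cycloMultSum f N s) := by
  classical
  let P : ℕ → ℕ → Prop := fun e d => ∃ p a, p.Prime ∧ ¬ p ∣ e ∧ 0 < a ∧ d = e * p ^ a
  let E : ℕ → Finset ℕ := fun t => (Finset.Icc 1 N).filter fun d => d.primeFactors.card = t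
  have h1 : ∀ e ∈ E s, ∑ d ∈ (E (s + 1)).filter (P e), cycloMult f d ≤ K * (A + cycloMult f e) := by
    intro e he
    refine sum_cycloMult_le hf hn hA hK ?_ _ fun d hd => (Finset.mem_filter.1 hd).2
    exact (Finset.mem_Icc.1 (Finset.mem_filter.1 he).1).1
  have h2 : ∀ d ∈ E (s + 1), s + 1 ≤ ((E s).filter fun e => P e d).card := by
    intro d hd
    obtain ⟨hdN, hds⟩ := Finset.mem_filter.1 hd
    obtain ⟨hd1, hdN⟩ := Finset.mem_Icc.1 hdN
    have hd0 : d ≠ 0 := by omega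
    rw [← hds, ← Finset.card_image_of_injOn (s := d.primeFactors) (f := fun p => ordCompl[p] d)]
    · refine Finset.card_le_card fun e he => ?_
      obtain ⟨p, hp, rfl⟩ := Finset.mem_image.1 he
      have hpp := Nat.prime_of_mem_primeFactors hp
      have hpd := Nat.dvd_of_mem_primeFactors hp
      simp only [E, P, Finset.mem_filter, Finset.mem_Icc]
      refine ⟨⟨⟨Nat.ordCompl_pos p hd0, (Nat.div_le_self _ _).trans hdN⟩, ?_⟩, p,
        d.factorization p, hpp, Nat.not_dvd_ordCompl hpp hd0,
        hpp.factorization_pos_of_dvd hd0 hpd, ?_⟩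
      · rw [primeFactors_ordCompl, Finset.card_erase_of_mem hp, hds, Nat.add_sub_cancel]
      · rw [mul_comm, Nat.ordProj_mul_ordCompl_eq_self]
    · intro p hp q hq hpq
      by_contra hne
      have h3 := congrArg Nat.primeFactors hpq
      simp only [primeFactors_ordCompl] at h3
      have h4 : q ∈ d.primeFactors.erase p := Finset.mem_erase.2 ⟨Ne.symm hne, hq⟩
      rw [h3] at h4
      exact Finset.notMem_erase _ _ h4
  calc (s + 1) * cycloMultSum f N (s + 1)
      = ∑ d ∈ E (s + 1), (s + 1) * cycloMult f d := by rw [cycloMultSum, Finset.mul_sum]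
    _ ≤ ∑ d ∈ E (s + 1), ((E s).filter fun e => P e d).card * cycloMult f d :=
        Finset.sum_le_sum fun d hd => Nat.mul_le_mul_right _ (h2 d hd)
    _ = ∑ d ∈ E (s + 1), ∑ e ∈ (E s).filter fun e => P e d, cycloMult f d := by simp
    _ = ∑ e ∈ E s, ∑ d ∈ (E (s + 1)).filter (P e), cycloMult f d := by
        refine Finset.sum_comm' fun d e => ?_
        simp only [Finset.mem_filter]
        tauto
    _ ≤ ∑ e ∈ E s, K * (A + cycloMult f e) := Finset.sum_le_sum h1
    _ = K * (A * (E s).card + cycloMultSum f N s) := by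
        rw [← Finset.mul_sum, Finset.sum_add_distrib, Finset.sum_const, smul_eq_mul, mul_comm A]
        rfl
    _ ≤ K * (A * N + cycloMultSum f N s) := by
        have : (E s).card ≤ N := (Finset.card_filter_le _ _).trans (by simp)
        gcongr

lemma cycloMultSum_zero {f : ℤ[X]} (hf1 : f.eval 1 ≠ 0) (N : ℕ) : cycloMultSum f N 0 = 0 := by
  refine Finset.sum_eq_zero fun d hd => ?_
  obtain ⟨hd1, hd2⟩ := Finset.mem_filter.1 hd
  obtain ⟨hd1, -⟩ := Finset.mem_Icc.1 hd1
  have h : d = 1 := by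
    rw [Finset.card_eq_zero, Nat.primeFactors_eq_empty] at hd2
    omega
  rw [h]
  by_contra h0
  have h1 := cycloMult_pos_iff.1 (Nat.pos_of_ne_zero h0)
  rw [cyclotomic_one] at h1
  exact hf1 (dvd_iff_isRoot.1 (by simpa using h1))

/-- Adding `A * N` to the sum makes the recursion multiplicative with factor `(K + s + 1) / (s +
1)`, the ratio of consecutive binomials. -/
lemma cycloMultSum_le {f : ℤ[X]} (hf1 : f.eval 1 ≠ 0) {n K A : ℕ} (hn : f.natDegree ≤ n)
    (hA : coeffNorm f ≤ (n : ℝ) ^ A) (hK : n ≤ 2 ^ K) (N s : ℕ) :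
    A * N + cycloMultSum f N s ≤ A * N * (K + s).choose s := by
  have hf : f ≠ 0 := by rintro rfl; simp at hf1
  induction s with
  | zero => simp [cycloMultSum_zero hf1]
  | succ s ih =>
    have h1 := succ_mul_cycloMultSum_succ_le hf hn hA hK N s
    have h2 := Nat.add_one_mul_choose_eq (K + s) s
    refine Nat.le_of_mul_le_mul_left (c := s + 1) ?_ (Nat.succ_pos s)
    calc (s + 1) * (A * N + cycloMultSum f N (s + 1))
        ≤ (s + 1) * (A * N) + K * (A * N + cycloMultSum f N s) := by rw [mul_add]; gcongr
      _ ≤ (K + s + 1) * (A * N + cycloMultSum f N s) := by nlinarith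
      _ ≤ (K + s + 1) * (A * N * (K + s).choose s) := by gcongr
      _ = (s + 1) * (A * N * (K + (s + 1)).choose (s + 1)) := by
        rw [← add_assoc]; linear_combination (A * N) * h2

/-! ### Elementary bounds for totients and numbers of prime factors -/

lemma Finset.card_add_one_le_of_forall_lt {s : Finset ℕ} {a b : ℕ} (hb : b ≤ a)
    (h : ∀ x ∈ s, b ≤ x ∧ x < a) : s.card + b ≤ a := by
  have h1 : s ⊆ Finset.Ico b a := fun x hx => Finset.mem_Ico.2 (h x hx)
  have h2 := Finset.card_le_card h1
  rw [Nat.card_Ico] at h2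
  omega

/-- The `i`-th smallest element is at least `i + 1`, so the product of the ratios `x / (x - 1)` is
at most the telescoping product of `(i + 1) / i`. -/
lemma Finset.prod_le_card_add_one_mul_prod_sub_one (s : Finset ℕ) (h : ∀ x ∈ s, 2 ≤ x) :
    ∏ x ∈ s, x ≤ (s.card + 1) * ∏ x ∈ s, (x - 1) := by
  induction s using Finset.induction_on_max with
  | empty => simp
  | insert a s ha ih =>
    have hs : ∀ x ∈ s, 2 ≤ x := fun x hx => h x (Finset.mem_insert_of_mem hx)
    have ha2 := h a (Finset.mem_insert_self _ _)
    have has : a ∉ s := fun hx => (ha a hx).false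
    have hc := Finset.card_add_one_le_of_forall_lt ha2 fun x hx => ⟨hs x hx, ha x hx⟩
    rw [Finset.prod_insert has, Finset.prod_insert has, Finset.card_insert_of_notMem has]
    obtain ⟨b, rfl⟩ : ∃ b, a = b + 1 := ⟨a - 1, by omega⟩
    rw [Nat.add_sub_cancel]
    calc (b + 1) * ∏ x ∈ s, x ≤ (b + 1) * ((s.card + 1) * ∏ x ∈ s, (x - 1)) :=
          Nat.mul_le_mul_left _ (ih hs)
      _ = ((b + 1) * (s.card + 1)) * ∏ x ∈ s, (x - 1) := by ring
      _ ≤ ((s.card + 1 + 1) * b) * ∏ x ∈ s, (x - 1) := Nat.mul_le_mul_right _ (by nlinarith)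
      _ = _ := by ring

lemma Finset.factorial_card_le_prod (s : Finset ℕ) (h : ∀ x ∈ s, 1 ≤ x) :
    s.card.factorial ≤ ∏ x ∈ s, x := by
  induction s using Finset.induction_on_max with
  | empty => simp
  | insert a s ha ih =>
    have hs : ∀ x ∈ s, 1 ≤ x := fun x hx => h x (Finset.mem_insert_of_mem hx)
    have has : a ∉ s := fun hx => (ha a hx).false
    have hc := Finset.card_add_one_le_of_forall_lt (h a (Finset.mem_insert_self _ _))
      fun x hx => ⟨hs x hx, ha x hx⟩
    rw [Finset.prod_insert has, Finset.card_insert_of_notMem has, Nat.factorial_succ]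
    exact Nat.mul_le_mul hc (ih hs)

lemma factorial_card_primeFactors_le {d : ℕ} (hd : 0 < d) : d.primeFactors.card.factorial ≤ d :=
  (Finset.factorial_card_le_prod _ fun _ hx => (Nat.prime_of_mem_primeFactors hx).one_le).trans
    (Nat.le_of_dvd hd (Nat.prod_primeFactors_dvd d))

lemma two_pow_card_primeFactors_le {d : ℕ} (hd : 0 < d) : 2 ^ d.primeFactors.card ≤ d := by
  refine le_trans ?_ (Nat.le_of_dvd hd (Nat.prod_primeFactors_dvd d))
  rw [← Finset.prod_const]
  exact Finset.prod_le_prod' fun x hx => (Nat.prime_of_mem_primeFactors hx).two_le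

lemma le_totient_mul_card_primeFactors_add_one (d : ℕ) :
    d ≤ d.totient * (d.primeFactors.card + 1) := by
  have h1 := Nat.totient_mul_prod_primeFactors d
  have h2 := Finset.prod_le_card_add_one_mul_prod_sub_one d.primeFactors
    fun x hx => (Nat.prime_of_mem_primeFactors hx).two_le
  have h3 : 0 < ∏ p ∈ d.primeFactors, (p - 1) :=
    Finset.prod_pos fun x hx => Nat.sub_pos_of_lt (Nat.prime_of_mem_primeFactors hx).one_lt
  refine Nat.le_of_mul_le_mul_right (c := ∏ p ∈ d.primeFactors, (p - 1)) ?_ h3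
  rw [← h1, mul_assoc]
  exact Nat.mul_le_mul_left _ h2

/-- With `w` prime factors, `2^w ≤ d ≤ φ(d) (w + 1) ≤ 2^K (w + 1)`, which fails for large `w`. -/
lemma card_primeFactors_lt_of_totient_le {d K : ℕ} (hd : 0 < d) (hK : d.totient ≤ 2 ^ K) :
    d.primeFactors.card < 2 * K + 4 := by
  set w := d.primeFactors.card with hw
  by_contra! h
  obtain ⟨t, ht⟩ : ∃ t, w = K + (t + 1) := ⟨w - K - 1, by omega⟩
  have h1 : 2 ^ w ≤ 2 ^ K * (w + 1) :=
    ((two_pow_card_primeFactors_le hd).trans (le_totient_mul_card_primeFactors_add_one d)).trans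
      (Nat.mul_le_mul_right _ hK)
  rw [show 2 ^ w = 2 ^ K * 2 ^ (t + 1) by rw [ht, pow_add]] at h1
  have h2 := Nat.le_of_mul_le_mul_left h1 (by positivity)
  have h3 : t + 1 ≤ 2 ^ t := Nat.lt_two_pow_self
  rw [pow_succ] at h2
  omega

/-! ### Counting the primes that divide indices of cyclotomic factors -/

lemma totient_le_of_cyclotomic_dvd {f : ℤ[X]} (hf : f ≠ 0) {d : ℕ}
    (hdf : cyclotomic d ℤ ∣ f) : d.totient ≤ f.natDegree := by
  rw [← natDegree_cyclotomic d ℤ]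
  exact natDegree_le_of_dvd hdf hf

lemma sum_totient_le {f : ℤ[X]} (hf : f ≠ 0) (T : Finset ℕ)
    (hT : ∀ d ∈ T, 0 < d ∧ cyclotomic d ℤ ∣ f) : ∑ d ∈ T, d.totient ≤ f.natDegree := by
  have h1 : ∏ d ∈ T, cyclotomic d ℤ ∣ f :=
    Finset.prod_dvd_of_isRelPrime
      (fun d hd e he hde => isRelPrime_cyclotomic (hT d hd).1 (hT e he).1 hde)
      fun d hd => (hT d hd).2
  have h2 := natDegree_le_of_dvd h1 hf
  rw [natDegree_prod _ _ fun d _ => cyclotomic_ne_zero d ℤ] at h2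
  simpa only [natDegree_cyclotomic] using h2

/-- Primes coming from large `d` with `Φ_d ∣ f`. -/
lemma card_primes_of_large_le {f : ℤ[X]} (hf : f ≠ 0) {n K : ℕ} (hn : f.natDegree ≤ n)
    (hK : n ≤ 2 ^ K) (N : ℕ) (P : Finset ℕ)
    (hP : ∀ p ∈ P, p.Prime ∧ ∃ d, 0 < d ∧ N ^ 2 ≤ d ∧ p ∣ d ∧ cyclotomic d ℤ ∣ f) :
    P.card * N ^ 2 ≤ (2 * K + 4) * (2 * K + 4) * n := by
  classical
  choose! hp d hd0 hdN hpd hdf using hP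
  set T := P.image d with hT
  have hT' : ∀ t ∈ T, 0 < t ∧ N ^ 2 ≤ t ∧ cyclotomic t ℤ ∣ f := by
    intro t ht
    obtain ⟨p, hpP, rfl⟩ := Finset.mem_image.1 ht
    exact ⟨hd0 p hpP, hdN p hpP, hdf p hpP⟩
  have hw : ∀ t ∈ T, t.primeFactors.card < 2 * K + 4 := fun t ht =>
    card_primeFactors_lt_of_totient_le (hT' t ht).1
      (((totient_le_of_cyclotomic_dvd hf (hT' t ht).2.2).trans hn).trans hK)
  -- Several primes may choose the same `d`, but no more than `d` has prime factors.
  have h1 : P.card ≤ (2 * K + 4) * T.card := by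
    have hsub : P ⊆ T.biUnion Nat.primeFactors := fun p hpP =>
      Finset.mem_biUnion.2 ⟨d p, Finset.mem_image_of_mem _ hpP,
        Nat.mem_primeFactors.2 ⟨hp p hpP, hpd p hpP, (hd0 p hpP).ne'⟩⟩
    rw [mul_comm]
    exact (Finset.card_le_card hsub).trans
      (Finset.card_biUnion_le_card_mul _ _ _ fun t ht => (hw t ht).le)
  have h2 : T.card * N ^ 2 ≤ (2 * K + 4) * n := by
    calc T.card * N ^ 2 = ∑ t ∈ T, N ^ 2 := by simp
      _ ≤ ∑ t ∈ T, (2 * K + 4) * t.totient := by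
        refine Finset.sum_le_sum fun t ht => (hT' t ht).2.1.trans ?_
        refine (le_totient_mul_card_primeFactors_add_one t).trans ?_
        rw [mul_comm]
        exact Nat.mul_le_mul_right _ (hw t ht)
      _ ≤ (2 * K + 4) * n := by
        rw [← Finset.mul_sum]
        exact Nat.mul_le_mul_left _
          ((sum_totient_le hf T fun t ht => ⟨(hT' t ht).1, (hT' t ht).2.2⟩).trans hn)
  calc P.card * N ^ 2 ≤ (2 * K + 4) * T.card * N ^ 2 := Nat.mul_le_mul_right _ h1
    _ = (2 * K + 4) * (T.card * N ^ 2) := by ring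
    _ ≤ (2 * K + 4) * ((2 * K + 4) * n) := Nat.mul_le_mul_left _ h2
    _ = _ := by ring

/-- Primes `p` with a factor `Φ_{e p^a}` of `f`, where `e ≤ N`. -/
lemma card_primes_of_small_cofactor_le {f : ℤ[X]} (hf : f ≠ 0) {n K A : ℕ}
    (hn : f.natDegree ≤ n) (hA : coeffNorm f ≤ (n : ℝ) ^ A) (hK : n ≤ 2 ^ K) (N : ℕ)
    (P : Finset ℕ)
    (hP : ∀ p ∈ P, p.Prime ∧ ∃ e ∈ Finset.Icc 1 N, ∃ a, 0 < a ∧ ¬ p ∣ e ∧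
      cyclotomic (e * p ^ a) ℤ ∣ f) :
    P.card ≤ K * (A * N + ∑ e ∈ Finset.Icc 1 N, cycloMult f e) := by
  classical
  let Q : ℕ → ℕ → Prop := fun e p => ∃ a, 0 < a ∧ ¬ p ∣ e ∧ cyclotomic (e * p ^ a) ℤ ∣ f
  have hpp : ∀ p ∈ P, p.Prime := fun p hp => (hP p hp).1
  have h1 : ∀ e ∈ Finset.Icc 1 N, (P.filter (Q e)).card ≤ K * (A + cycloMult f e) := by
    intro e he
    have he0 : 0 < e := (Finset.mem_Icc.1 he).1
    have hQ : ∀ p ∈ P.filter (Q e), p.Prime ∧ Q e p := fun p hp =>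
      ⟨hpp p (Finset.mem_filter.1 hp).1, (Finset.mem_filter.1 hp).2⟩
    choose! hp a ha hpe hdf using hQ
    have hinj : Set.InjOn (fun p => e * p ^ a p) (P.filter (Q e)) := by
      intro p hpP q hqP hpq
      have h2 : p ^ a p = q ^ a q := Nat.eq_of_mul_eq_mul_left he0 hpq
      have h3 : p ∣ q ^ a q := h2 ▸ dvd_pow_self p (ha p hpP).ne'
      exact (Nat.prime_dvd_prime_iff_eq (hp p hpP) (hp q hqP)).1 ((hp p hpP).dvd_of_dvd_pow h3)
    rw [← Finset.card_image_of_injOn hinj]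
    refine le_trans ?_ (sum_cycloMult_le hf hn hA hK he0
      ((P.filter (Q e)).image fun p => e * p ^ a p) ?_)
    -- Each `Φ_{e p^a}` divides `f`, so it contributes at least 1 to the sum of multiplicities.
    · rw [Finset.card_eq_sum_ones]
      refine Finset.sum_le_sum fun d hd => ?_
      obtain ⟨p, hpP, rfl⟩ := Finset.mem_image.1 hd
      exact cycloMult_pos_iff.2 (hdf p hpP)
    · intro d hd
      obtain ⟨p, hpP, rfl⟩ := Finset.mem_image.1 hd
      exact ⟨p, a p, hp p hpP, hpe p hpP, ha p hpP, rfl⟩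
  have hsub : P ⊆ (Finset.Icc 1 N).biUnion fun e => P.filter (Q e) := by
    intro p hp
    obtain ⟨-, e, he, h⟩ := hP p hp
    exact Finset.mem_biUnion.2 ⟨e, he, Finset.mem_filter.2 ⟨hp, h⟩⟩
  calc P.card ≤ _ := Finset.card_le_card hsub
    _ ≤ ∑ e ∈ Finset.Icc 1 N, (P.filter (Q e)).card := Finset.card_biUnion_le
    _ ≤ ∑ e ∈ Finset.Icc 1 N, K * (A + cycloMult f e) := Finset.sum_le_sum h1
    _ = _ := by
      rw [← Finset.mul_sum, Finset.sum_add_distrib]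
      simp [mul_comm]

/-- Grouping by number `s` of prime factors leaves at most `K + 1` classes, since `2^s ≤ e ≤ 2^K`;
classes with `s! > n` are empty because `s! ≤ e`. -/
lemma sum_Icc_cycloMult_le {f : ℤ[X]} (hf1 : f.eval 1 ≠ 0) {n K A X : ℕ} (hn : f.natDegree ≤ n)
    (hA : coeffNorm f ≤ (n : ℝ) ^ A) (hK : n ≤ 2 ^ K) {N : ℕ} (hN : N ≤ n)
    (hX : ∀ s, s.factorial ≤ n → (K + s).choose s ≤ X) :
    ∑ e ∈ Finset.Icc 1 N, cycloMult f e ≤ (K + 1) * (A * N * X) := by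
  have h1 : ∀ e ∈ Finset.Icc 1 N, e.primeFactors.card ∈ Finset.range (K + 1) := by
    intro e he
    obtain ⟨he1, heN⟩ := Finset.mem_Icc.1 he
    rw [Finset.mem_range, Nat.lt_succ_iff, ← Nat.pow_le_pow_iff_right (a := 2) (by norm_num)]
    exact (two_pow_card_primeFactors_le he1).trans ((heN.trans hN).trans hK)
  rw [← Finset.sum_fiberwise_of_maps_to h1]
  refine (Finset.sum_le_card_nsmul _ _ (A * N * X) fun s _ => ?_).trans (by simp)
  change cycloMultSum f N s ≤ _
  by_cases hs : s.factorial ≤ n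
  · calc cycloMultSum f N s ≤ A * N + cycloMultSum f N s := Nat.le_add_left _ _
      _ ≤ _ := cycloMultSum_le hf1 hn hA hK N s
      _ ≤ _ := Nat.mul_le_mul_left _ (hX s hs)
  · rw [cycloMultSum, Finset.filter_false_of_mem, Finset.sum_empty]
    · exact Nat.zero_le _
    · rintro e he rfl
      obtain ⟨he1, heN⟩ := Finset.mem_Icc.1 he
      exact hs ((factorial_card_primeFactors_le he1).trans (heN.trans hN))

/-- Bound for the number of primes dividing some `d` with `Φ_d ∣ f`. -/
lemma card_primes_mul_sq_le {f : ℤ[X]} (hf1 : f.eval 1 ≠ 0) {n K A X : ℕ}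
    (hn : f.natDegree ≤ n) (hA : coeffNorm f ≤ (n : ℝ) ^ A) (hK : n ≤ 2 ^ K) {N : ℕ} (hN : N ≤ n)
    (hX : ∀ s, s.factorial ≤ n → (K + s).choose s ≤ X) (P : Finset ℕ)
    (hP : ∀ p ∈ P, p.Prime ∧ ∃ d, 0 < d ∧ p ∣ d ∧ cyclotomic d ℤ ∣ f) :
    P.card * N ^ 2 ≤ (N + K * (A * N + (K + 1) * (A * N * X))) * N ^ 2 +
      (2 * K + 4) * (2 * K + 4) * n := by
  classical
  have hf : f ≠ 0 := by rintro rfl; simp at hf1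
  let QB : ℕ → Prop := fun p => ∃ e ∈ Finset.Icc 1 N, ∃ a, 0 < a ∧ ¬ p ∣ e ∧
      cyclotomic (e * p ^ a) ℤ ∣ f
  let QA : ℕ → Prop := fun p => ∃ d, 0 < d ∧ N ^ 2 ≤ d ∧ p ∣ d ∧ cyclotomic d ℤ ∣ f
  have hA' := card_primes_of_large_le hf hn hK N (P.filter QA) fun p hp =>
    ⟨(hP p (Finset.mem_filter.1 hp).1).1, (Finset.mem_filter.1 hp).2⟩
  have hB' := (card_primes_of_small_cofactor_le hf hn hA hK N (P.filter QB) fun p hp =>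
    ⟨(hP p (Finset.mem_filter.1 hp).1).1, (Finset.mem_filter.1 hp).2⟩).trans
      (Nat.mul_le_mul_left _ (Nat.add_le_add_left (sum_Icc_cycloMult_le hf1 hn hA hK hN hX) _))
  have hsub : P ⊆ (Finset.Icc 1 N ∪ P.filter QB) ∪ P.filter QA := by
    intro p hp
    obtain ⟨hpp, d, hd0, hpd, hdf⟩ := hP p hp
    simp only [Finset.mem_union, Finset.mem_filter, hp, true_and, Finset.mem_Icc]
    by_cases hpN : p ≤ N
    · exact Or.inl (Or.inl ⟨hpp.one_le, hpN⟩)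
    have hd : ordCompl[p] d * p ^ d.factorization p = d := by
      rw [mul_comm, Nat.ordProj_mul_ordCompl_eq_self]
    have ha : 0 < d.factorization p := hpp.factorization_pos_of_dvd hd0.ne' hpd
    by_cases heN : ordCompl[p] d ≤ N
    · exact Or.inl (Or.inr ⟨_, Finset.mem_Icc.2 ⟨Nat.ordCompl_pos p hd0.ne', heN⟩, _, ha,
        Nat.not_dvd_ordCompl hpp hd0.ne', by rwa [hd]⟩)
    · refine Or.inr ⟨d, hd0, ?_, hpd, hdf⟩
      rw [sq, ← hd]
      exact Nat.mul_le_mul (not_le.1 heN).le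
        ((not_le.1 hpN).le.trans (Nat.le_self_pow ha.ne' p))
  have h1 : P.card ≤ N + (P.filter QB).card + (P.filter QA).card := by
    refine (Finset.card_le_card hsub).trans ((Finset.card_union_le _ _).trans ?_)
    refine Nat.add_le_add_right ((Finset.card_union_le _ _).trans ?_) _
    simp
  calc P.card * N ^ 2 ≤ (N + (P.filter QB).card + (P.filter QA).card) * N ^ 2 :=
        Nat.mul_le_mul_right _ h1
    _ = (N + (P.filter QB).card) * N ^ 2 + (P.filter QA).card * N ^ 2 := by ring
    _ ≤ _ := Nat.add_le_add (Nat.mul_le_mul_right _ (Nat.add_le_add_left hB' _)) hA'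

/-! ### The common multiple and the exponent it yields -/

lemma pow_factorization_le_of_totient_le {d n p : ℕ} (hd : 0 < d) (hp : p.Prime)
    (hn : d.totient ≤ n) : p ^ d.factorization p ≤ 2 * n := by
  have h1 : (p ^ d.factorization p).totient ≤ n :=
    (Nat.le_of_dvd (Nat.totient_pos.2 hd)
      (Nat.totient_dvd_of_dvd (Nat.ordProj_dvd d p))).trans hn
  refine le_trans ?_ (Nat.mul_le_mul_left 2 h1)
  cases d.factorization p with
  | zero => simp
  | succ k =>
    rw [Nat.totient_prime_pow_succ hp, pow_succ]
    have := hp.two_le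
    calc p ^ k * p ≤ p ^ k * (2 * (p - 1)) := Nat.mul_le_mul_left _ (by omega)
      _ = _ := by ring

/-- A common multiple of all `d` with `Φ_d ∣ f`. -/
lemma exists_common_multiple {f : ℤ[X]} (hf : f ≠ 0) {n : ℕ} (hn : f.natDegree ≤ n)
    (hn0 : 0 < n) : ∃ (P : Finset ℕ) (L : ℕ),
      (∀ p ∈ P, p.Prime ∧ ∃ d, 0 < d ∧ p ∣ d ∧ cyclotomic d ℤ ∣ f) ∧ 0 < L ∧
      L ≤ (2 * n) ^ P.card ∧ ∀ d, 0 < d → cyclotomic d ℤ ∣ f → d ∣ L := by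
  classical
  let P := (Finset.Icc 1 (2 * n)).filter
    fun p => p.Prime ∧ ∃ d, 0 < d ∧ p ∣ d ∧ cyclotomic d ℤ ∣ f
  have hP : ∀ p ∈ P, p.Prime := fun p hp => (Finset.mem_filter.1 hp).2.1
  -- Each factor is the largest power of `p` not exceeding `2n`.
  refine ⟨P, ∏ p ∈ P, p ^ Nat.log p (2 * n), fun p hp => (Finset.mem_filter.1 hp).2,
    Finset.prod_pos fun p hp => pow_pos (hP p hp).pos _, ?_, ?_⟩
  · exact Finset.prod_le_pow_card _ _ _ fun p _ => Nat.pow_log_le_self p (by omega)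
  · intro d hd hdf
    have hle : ∀ p ∈ d.primeFactors, p ^ d.factorization p ≤ 2 * n := fun p hp =>
      pow_factorization_le_of_totient_le hd (Nat.prime_of_mem_primeFactors hp)
        ((totient_le_of_cyclotomic_dvd hf hdf).trans hn)
    have hsub : d.primeFactors ⊆ P := by
      intro p hp
      have hpp := Nat.prime_of_mem_primeFactors hp
      have hpd := Nat.dvd_of_mem_primeFactors hp
      have h0 := hpp.factorization_pos_of_dvd hd.ne' hpd
      exact Finset.mem_filter.2 ⟨Finset.mem_Icc.2 ⟨hpp.one_le,
        (Nat.le_self_pow h0.ne' p).trans (hle p hp)⟩, hpp, d, hd, hpd, hdf⟩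
    refine dvd_trans ?_ (Finset.prod_dvd_prod_of_subset _ _ _ hsub)
    conv_lhs => rw [← Nat.prod_factorization_pow_eq_self hd.ne']
    rw [Finsupp.prod, Nat.support_factorization]
    refine Finset.prod_dvd_prod_of_dvd _ _ fun p hp => pow_dvd_pow p ?_
    exact Nat.le_log_of_pow_le (Nat.prime_of_mem_primeFactors hp).one_lt (hle p hp)

/-- The factors of `x^k - 1` not dividing `q` are coprime to `q` and can be dropped; the others have
index dividing `m * L`. The same `l` serves. -/
lemma mul_mem_cycloExponents {q f : ℤ[X]} {m L : ℕ} (hm : 0 < m) (hL : 0 < L)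
    (hq : q ∣ (X ^ m - 1) * f) (hLf : ∀ d, 0 < d → cyclotomic d ℤ ∣ f → d ∣ L)
    (hne : (cycloExponents q).Nonempty) : m * L ∈ cycloExponents q := by
  classical
  obtain ⟨k, hk, l, hl, hqk⟩ := hne
  have hmL : 0 < m * L := Nat.mul_pos hm hL
  refine ⟨hmL, l, hl, ?_⟩
  rw [← prod_cyclotomic_eq_X_pow_sub_one hk,
    ← Finset.prod_filter_mul_prod_filter_not k.divisors fun d => cyclotomic d ℤ ∣ q,
    ← mul_assoc] at hqk
  have hrel : IsRelPrime q
      (∏ d ∈ k.divisors.filter fun d => ¬ cyclotomic d ℤ ∣ q, cyclotomic d ℤ) := by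
    refine IsRelPrime.prod_right fun d hd => ?_
    obtain ⟨hd, hdq⟩ := Finset.mem_filter.1 hd
    exact (((cyclotomic.irreducible (Nat.pos_of_mem_divisors hd)).isRelPrime_iff_not_dvd).2
      hdq).symm
  refine (hrel.dvd_of_dvd_mul_right hqk).trans (mul_dvd_mul_left _ ?_)
  rw [← prod_cyclotomic_eq_X_pow_sub_one hmL]
  refine Finset.prod_dvd_prod_of_subset _ _ _ fun d hd => ?_
  obtain ⟨hd, hdq⟩ := Finset.mem_filter.1 hd
  have hd0 := Nat.pos_of_mem_divisors hd
  refine Nat.mem_divisors.2 ⟨?_, hmL.ne'⟩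
  rcases (prime_cyclotomic hd0).dvd_or_dvd (hdq.trans hq) with h | h
  · rw [← prod_cyclotomic_eq_X_pow_sub_one hm, (prime_cyclotomic hd0).dvd_finsetProd_iff] at h
    obtain ⟨e, he, hde⟩ := h
    have he0 := Nat.pos_of_mem_divisors he
    by_cases hed : d = e
    · exact hed ▸ (Nat.dvd_of_mem_divisors he).mul_right L
    · exact absurd hde (((cyclotomic.irreducible hd0).isRelPrime_iff_not_dvd).1
        (isRelPrime_cyclotomic hd0 he0 hed))
  · exact (hLf d hd0 h).mul_left m

/-! ### Asymptotic estimates and conclusion -/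

/-- The left side is one term of the binomial expansion of `(x + (1 - x)) ^ (K + s) = 1`. -/
lemma choose_mul_pow_mul_pow_le_one {x : ℝ} (hx0 : 0 ≤ x) (hx1 : x ≤ 1) (K s : ℕ) :
    ((K + s).choose s : ℝ) * x ^ s * (1 - x) ^ K ≤ 1 := by
  have h1 : (x + (1 - x)) ^ (K + s) = 1 := by simp
  rw [add_pow] at h1
  have h2 := Finset.single_le_sum (s := Finset.range (K + s + 1))
    (f := fun i => x ^ i * (1 - x) ^ (K + s - i) * ((K + s).choose i : ℝ))
    (fun i _ => by have := sub_nonneg.2 hx1; positivity) (Finset.mem_range.2 (by omega : s < _))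
  refine le_trans (le_of_eq ?_) (h2.trans h1.le)
  simp only [Nat.add_sub_cancel]
  ring

/-- The binomial coefficients `C(K + s, s)` with `K ≈ log₂ n` and `s! ≤ n` are `n ^ o(1)`. -/
lemma eventually_choose_le_rpow {δ : ℝ} (hδ : 0 < δ) :
    ∀ᶠ n : ℕ in Filter.atTop, ∀ K s : ℕ, 2 ^ K ≤ 2 * n → s.factorial ≤ n →
      ((K + s).choose s : ℝ) ≤ (n : ℝ) ^ δ := by
  -- `y` and `B` are chosen so that `y ^ K` and `x ^ s` are the `-η`-th powers of `2 ^ K` and `B ^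
  -- s`; the product of these two is at most `n ^ 4`, whence the 4.
  set η := δ / 4 with hη
  have hη0 : 0 < η := by positivity
  set y : ℝ := (2 : ℝ) ^ (-η) with hy
  have hy0 : 0 < y := by positivity
  have hy1 : y < 1 := Real.rpow_lt_one_of_one_lt_of_neg (by norm_num) (by linarith)
  set x := 1 - y with hx
  have hx0 : 0 < x := by linarith
  set B : ℝ := x ^ (-(1 / η)) with hB
  have hB0 : 0 < B := by positivity
  filter_upwards [Filter.eventually_ge_atTop (max 1 ⌈2 * Real.exp B⌉₊)] with n hn K s hK hs
  have hn1 : (1 : ℝ) ≤ n := by exact_mod_cast (le_max_left _ _).trans hn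
  have hnB : 2 * Real.exp B ≤ n := (Nat.le_ceil _).trans
    (by exact_mod_cast (le_max_right _ _).trans hn)
  have h1 := choose_mul_pow_mul_pow_le_one hx0.le (by linarith : x ≤ 1) K s
  rw [show 1 - x = y by rw [hx]; ring] at h1
  have hxs : x ^ s = (B ^ s) ^ (-η) := by
    rw [hB, ← Real.rpow_natCast, ← Real.rpow_natCast, ← Real.rpow_mul hx0.le,
      ← Real.rpow_mul hx0.le]
    congr 1
    field_simp
  have hyK : y ^ K = ((2 : ℝ) ^ K) ^ (-η) := by
    rw [hy, ← Real.rpow_natCast, ← Real.rpow_natCast, ← Real.rpow_mul (by norm_num),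
      ← Real.rpow_mul (by norm_num), mul_comm]
  -- One term of the exponential series, `B^s / s! ≤ exp B`, together with `s! ≤ n`.
  have hBs : B ^ s ≤ n * Real.exp B := by
    have h2 := Real.pow_div_factorial_le_exp B hB0.le s
    rw [div_le_iff₀ (by positivity)] at h2
    have h3 : (s.factorial : ℝ) ≤ n := by exact_mod_cast hs
    nlinarith [Real.exp_pos B]
  have h2K : (2 : ℝ) ^ K ≤ 2 * n := by exact_mod_cast hK
  have hprod : B ^ s * 2 ^ K ≤ (n : ℝ) ^ 4 := by
    calc B ^ s * 2 ^ K ≤ (n * Real.exp B) * (2 * n) := by gcongr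
      _ = (2 * Real.exp B) * n ^ 2 * 1 := by ring
      _ ≤ n * n ^ 2 * n := by gcongr
      _ = _ := by ring
  rw [mul_assoc, hxs, hyK, ← Real.mul_rpow (by positivity) (by positivity),
    Real.rpow_neg (by positivity), ← div_eq_mul_inv, div_le_one (by positivity)] at h1
  refine h1.trans ((Real.rpow_le_rpow (by positivity) hprod hη0.le).trans (le_of_eq ?_))
  rw [← Real.rpow_natCast, ← Real.rpow_mul (by positivity)]
  congr 1
  rw [hη]
  push_cast
  ring

lemma eventually_log_le_rpow {δ : ℝ} (hδ : 0 < δ) (a b : ℝ) :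
    ∀ᶠ n : ℕ in Filter.atTop, a * Real.log n + b ≤ (n : ℝ) ^ δ := by
  have h1 : (fun x : ℝ => a * Real.log x + b) =o[Filter.atTop] fun x => x ^ δ :=
    ((isLittleO_log_rpow_atTop hδ).const_mul_left a).add
      (Asymptotics.isLittleO_const_left.2 (Or.inr
        (tendsto_norm_atTop_atTop.comp (tendsto_rpow_atTop hδ))))
  have h2 := (h1.comp_tendsto tendsto_natCast_atTop_atTop).bound one_pos
  filter_upwards [h2] with n hn
  simp only [Function.comp_apply, one_mul] at hn
  rw [Real.norm_of_nonneg (by positivity : (0 : ℝ) ≤ (n : ℝ) ^ δ)] at hn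
  exact (Real.le_norm_self _).trans hn

/-- `E` stands for `n ^ (ε / 7)` and absorbs constants, `K` and `log (2n)`: the prime count costs `E
^ 5`, `log (2n)` one more factor, and adding `log m` the seventh. -/
lemma log_common_multiple_le {n m K N c L : ℕ} {E : ℝ} (hn : 1 ≤ n) (hm : 0 < m) (hmn : m ≤ n)
    (hL0 : 0 < L) (hL : L ≤ (2 * n) ^ c) (hE : 100 ≤ E) (hK : (K : ℝ) ≤ E)
    (hlog : Real.log (2 * n) ≤ E) (hN : N = ⌈(n : ℝ) ^ (1 / 3 : ℝ)⌉₊)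
    (hc : c * N ^ 2 ≤ (N + K * (100 * N + (K + 1) * (100 * N * ⌊E⌋₊))) * N ^ 2 +
      (2 * K + 4) * (2 * K + 4) * n) :
    Real.log ((m * L : ℕ) : ℝ) ≤ (n : ℝ) ^ (1 / 3 : ℝ) * E ^ 7 := by
  set r : ℝ := (n : ℝ) ^ (1 / 3 : ℝ) with hr
  have hn1 : (1 : ℝ) ≤ n := by exact_mod_cast hn
  have hr1 : 1 ≤ r := Real.one_le_rpow hn1 (by norm_num)
  have hr3 : r ^ 3 = n := by
    rw [hr, ← Real.rpow_natCast, ← Real.rpow_mul (by positivity)]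
    norm_num
  have hNr : r ≤ N := hN ▸ Nat.le_ceil _
  have hN2 : (N : ℝ) ≤ 2 * r := by
    have := Nat.ceil_lt_add_one (by positivity : 0 ≤ r)
    rw [← hN] at this
    linarith
  have hF : ((⌊E⌋₊ : ℕ) : ℝ) ≤ E := Nat.floor_le (by linarith)
  have hK0 : (0 : ℝ) ≤ K := Nat.cast_nonneg _
  have hcR : (c : ℝ) * N ^ 2 ≤ (N + K * (100 * N + (K + 1) * (100 * N * (⌊E⌋₊ : ℕ)))) * N ^ 2 +
      (2 * K + 4) * (2 * K + 4) * n := by exact_mod_cast hc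
  have h1 : (N : ℝ) + K * (100 * N + (K + 1) * (100 * N * (⌊E⌋₊ : ℕ))) ≤ 8 * E ^ 4 * r := by
    calc (N : ℝ) + K * (100 * N + (K + 1) * (100 * N * (⌊E⌋₊ : ℕ)))
        ≤ 2 * r + E * (E * (2 * r) + (E + E) * (E * (2 * r) * E)) := by
          gcongr
          linarith
      _ = (2 + 2 * E ^ 2 + 4 * E ^ 4) * r := by ring
      _ ≤ 8 * E ^ 4 * r := by
          gcongr
          nlinarith [sq_nonneg (E ^ 2), mul_le_mul hE hE (by norm_num) (by linarith)]
  have h2 : (2 * K + 4 : ℝ) * (2 * K + 4) * n ≤ E ^ 4 * r * N ^ 2 := by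
    calc (2 * K + 4 : ℝ) * (2 * K + 4) * n ≤ (3 * E) * (3 * E) * r ^ 3 := by
          rw [hr3]
          gcongr <;> linarith
      _ = 9 * E ^ 2 * r * r ^ 2 := by ring
      _ ≤ E ^ 4 * r * N ^ 2 := by
          gcongr
          nlinarith [sq_nonneg E, mul_le_mul hE hE (by norm_num) (by linarith)]
  have hc' : (c : ℝ) ≤ E ^ 5 * r := by
    have h3 : (c : ℝ) * N ^ 2 ≤ (9 * E ^ 4 * r) * N ^ 2 := by
      refine hcR.trans ?_
      have := mul_le_mul_of_nonneg_right h1 (by positivity : (0 : ℝ) ≤ (N : ℝ) ^ 2)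
      linarith
    have hN0 : (0 : ℝ) < N := by linarith
    have h4 := le_of_mul_le_mul_right h3 (by positivity)
    refine h4.trans ?_
    rw [pow_succ' E 4]
    gcongr
    linarith
  have hlogL : Real.log L ≤ E ^ 5 * r * E := by
    calc Real.log L ≤ Real.log ((2 * n : ℝ) ^ c) :=
          Real.log_le_log (by exact_mod_cast hL0) (by exact_mod_cast hL)
      _ = c * Real.log (2 * n) := Real.log_pow _ _
      _ ≤ _ := by
        gcongr
        exact Real.log_nonneg (by linarith)
  have hlogm : Real.log m ≤ E := by
    refine (Real.log_le_log (by exact_mod_cast hm) ?_).trans hlog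
    have : (m : ℝ) ≤ n := by exact_mod_cast hmn
    linarith
  rw [Nat.cast_mul, Real.log_mul (by exact_mod_cast hm.ne') (by exact_mod_cast hL0.ne')]
  calc Real.log m + Real.log L ≤ E * 1 * 1 + E ^ 6 * r * 1 := by linarith
    _ ≤ E * E ^ 5 * r + E ^ 6 * r * (E - 1) := by
      gcongr
      · exact one_le_pow₀ (by linarith)
      · linarith
    _ = r * E ^ 7 := by ring

theorem theoremt1 (ε : ℝ) (hε : 0 < ε) :
    ∃ n₀ : ℕ, ∀ (q f : ℤ[X]) (m n : ℕ) (c : ℝ),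
      f.eval 1 ≠ 0 → 0 < m → q ∣ (X ^ m - 1) * f →
      n = ((X ^ m - 1) * f).natDegree → n₀ ≤ n →
      c < 100 * Real.log 2 - 2 → coeffNorm f ≤ (n : ℝ) ^ c →
      (cycloExponents q).Nonempty →
      ∃ k : ℕ, IsLeast (cycloExponents q) k ∧
        Real.log (k : ℝ) ≤ (n : ℝ) ^ ((1 : ℝ) / 3 + ε) := by
  have hδ : 0 < ε / 7 := by positivity
  obtain ⟨n₀, hn₀⟩ := Filter.eventually_atTop.1 ((Filter.eventually_ge_atTop 1).and
    ((eventually_choose_le_rpow hδ).and ((eventually_log_le_rpow hδ 0 100).and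
      ((eventually_log_le_rpow hδ 1 (Real.log 2)).and
        (eventually_log_le_rpow hδ (1 / Real.log 2) 1)))))
  refine ⟨n₀, fun q f m n c hf1 hm hq hn hn₀n hc hnorm hne => ?_⟩
  obtain ⟨hn1, hchoose, h100, hlog2n, hlogK⟩ := hn₀ n hn₀n
  refine ⟨sInf (cycloExponents q), ⟨Nat.sInf_mem hne, fun k hk => Nat.sInf_le hk⟩, ?_⟩
  have hf : f ≠ 0 := by rintro rfl; simp at hf1
  have hdeg : n = m + f.natDegree := by
    rw [hn, natDegree_mul (by simpa using X_pow_sub_C_ne_zero hm (1 : ℤ)) hf]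
    congr 1
    simpa using natDegree_X_pow_sub_C (R := ℤ) (n := m) (r := 1)
  have hfn : f.natDegree ≤ n := by omega
  have hn1' : (1 : ℝ) ≤ n := by exact_mod_cast hn1
  -- As `log 2 < 1`, the exponent `c` is below 100, and the natural number `A = 100` can replace it.
  have hnorm' : coeffNorm f ≤ (n : ℝ) ^ 100 := by
    refine hnorm.trans ?_
    rw [← Real.rpow_natCast]
    refine Real.rpow_le_rpow_of_exponent_le hn1' ?_
    have := Real.log_two_lt_d9
    push_cast
    linarith
  set K := Nat.clog 2 n with hK
  have hnK : n ≤ 2 ^ K := Nat.le_pow_clog (by norm_num) n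
  have hKn : 2 ^ K ≤ 2 * n := by
    rcases Nat.eq_zero_or_pos K with h0 | h0
    · rw [h0]; omega
    · obtain ⟨j, hj⟩ : ∃ j, K = j + 1 := ⟨K - 1, by omega⟩
      have h1 : 2 ^ j < n := Nat.pow_lt_of_lt_clog (by omega)
      rw [hj, pow_succ]
      omega
  have hKE : (K : ℝ) ≤ (n : ℝ) ^ (ε / 7) := by
    refine le_trans ?_ hlogK
    have h2 : (0 : ℝ) < Real.log 2 := Real.log_pos (by norm_num)
    have h1 : Real.log ((2 : ℝ) ^ K) ≤ Real.log (2 * n) :=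
      Real.log_le_log (by positivity) (by exact_mod_cast hKn)
    rw [Real.log_pow, Real.log_mul (by norm_num) (by positivity)] at h1
    rw [one_div, inv_mul_eq_div, ← sub_le_iff_le_add, le_div_iff₀ h2]
    linarith
  set E : ℝ := (n : ℝ) ^ (ε / 7) with hE
  have hE100 : 100 ≤ E := by linarith
  set N := ⌈(n : ℝ) ^ (1 / 3 : ℝ)⌉₊ with hN
  have hNn : N ≤ n := by
    refine Nat.ceil_le.2 ?_
    exact (Real.rpow_le_rpow_of_exponent_le hn1' (by norm_num : (1 / 3 : ℝ) ≤ 1)).trans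
      (Real.rpow_one _).le
  obtain ⟨P, L, hP, hL0, hL, hLd⟩ := exists_common_multiple hf hfn hn1
  have hcard := card_primes_mul_sq_le hf1 hfn hnorm' hnK hNn
    (fun s hs => Nat.le_floor (hchoose K s hKn hs)) P hP
  have hmain := log_common_multiple_le hn1 hm (by omega) hL0 hL hE100 hKE
    (by rw [Real.log_mul (by norm_num) (by positivity)]; linarith) hN hcard
  have hmem := mul_mem_cycloExponents hm hL0 hq hLd hne
  calc Real.log ((sInf (cycloExponents q) : ℕ) : ℝ) ≤ Real.log ((m * L : ℕ) : ℝ) :=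
        Real.log_le_log (by exact_mod_cast (Nat.sInf_mem hne).1)
          (by exact_mod_cast Nat.sInf_le hmem)
    _ ≤ (n : ℝ) ^ (1 / 3 : ℝ) * E ^ 7 := hmain
    _ = (n : ℝ) ^ ((1 : ℝ) / 3 + ε) := by
      rw [hE, ← Real.rpow_natCast, ← Real.rpow_mul (by positivity),
        ← Real.rpow_add (by positivity)]
      congr 1
      push_cast
      ring
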